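/- Let $\delta(*)$ be a (nonzero) limit ordinal and let $\lambda$ be a cardinal with $\lambda=\mathrm{cf}(\lambda)>|\delta(*)|^{+}$. For a set $C$ of ordinals, $\mathrm{otp}(C)$ denotes its order type and $\mathrm{nacc}(C)$ denotes the set of those $\beta\in C$ that are not accumulation points of $C$ (that is, $\beta = 0$ or $\sup(C\cap\beta)<\beta$). A club of a limit ordinal $\delta$ is a closed unbounded subset of $\delta$. Then there are a stationary set $S\subseteq\{\delta<\lambda:\mathrm{cf}(\delta)=\mathrm{cf}(\delta(*))\}$ and sequences $\langle\mathcal P^*_{1,\alpha}:\alpha<\lambda\rangle$ and $\langle\mathcal P^*_{2,\alpha}:\alpha<\lambda\rangle$ such that: (A) for every $\alpha<\lambda$, $\mathcal P^*_{1,\alpha}$ is a family of fewer than $\lambda$ closed subsets of $\alpha$, each of order type $<\delta(*)$; (B) if $\alpha<\lambda$, $C\in\mathcal P^*_{1,\alpha}$ and $\beta\in\mathrm{nacc}(C)$, then $C\cap\beta\in\mathcal P^*_{1,\beta}$; (C) for every $\delta<\lambda$, $\mathcal P^*_{2,\delta}$ is a (possibly empty) family of at most $\lambda$ clubs of $\delta$,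 each of order type $\delta(*)$, and if $C\in\mathcal P^*_{2,\delta}$ and $\beta\in\mathrm{nacc}(C)$, then $C\cap\beta\in\mathcal P^*_{1,\beta}$ (in particular $\mathcal P^*_{2,\delta}=\emptyset$ unless $\delta$ is a limit ordinal with $\mathrm{cf}(\delta)=\mathrm{cf}(\delta(*))$); (D) for every club $E$ of $\lambda$ there is $\delta\in E\cap S$ such that $\mathrm{cf}(\delta)=\mathrm{cf}(\delta(*))$ and some $C\in\mathcal P^*_{2,\delta}$ satisfies $C\subseteq E$. -/

import Mathlib

open Cardinal Ordinal Order Set Topology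
open scoped Filter

universe u

/-- The order type of a set of ordinals. It lives one universe up: for a bounded set `C` it is
the lift of an ordinal of the original universe. -/
noncomputable def otp (C : Set Ordinal.{u}) : Ordinal.{u + 1} :=
  Ordinal.type (fun a b : C => a < b)

/-- `C` is a closed subset of the ordinal `α = {β | β < α}` (order topology of `α`). -/
def IsClosedSubset (C : Set Ordinal.{u}) (α : Ordinal.{u}) : Prop :=
  C ⊆ Iio α ∧ IsClosed (Subtype.val ⁻¹' C : Set (Iio α))

/-- `C` is a club (closed unbounded subset) of the ordinal `α`. -/
def IsClubOf (C : Set Ordinal.{u}) (α : Ordinal.{u}) : Prop :=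
  C ⊆ Iio α ∧ IsClub (Subtype.val ⁻¹' C : Set (Iio α))

/-- `S` is a stationary subset of the ordinal `α`. -/
def IsStationaryIn (S : Set Ordinal.{u}) (α : Ordinal.{u}) : Prop :=
  S ⊆ Iio α ∧ IsStationary (Subtype.val ⁻¹' S : Set (Iio α))

/-- `nacc(C)`: the points of `C` that are not accumulation points of `C`. -/
def nacc (C : Set Ordinal.{u}) : Set Ordinal.{u} :=
  {β ∈ C | ¬ AccPt β (𝓟 C)}

/-- The club guessing property of the families `⟨P₁ α : α < lam⟩`, `⟨P₂ α : α < lam⟩` on `S`, with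
guessing clubs of order type `δs`. The ordinals below the cardinal `lam` are those below `lam.ord`;
the values of `P₁`, `P₂` elsewhere play no role. -/
structure GuessingFamilies (lam : Cardinal.{u}) (δs : Ordinal.{u}) (S : Set Ordinal.{u})
    (P₁ P₂ : Ordinal.{u} → Set (Set Ordinal.{u})) : Prop where
  /-- `P₁ α` has fewer than `lam` members. -/
  card_fst : ∀ α < lam.ord, #(P₁ α) < Cardinal.lift.{u + 1} lam
  /-- The members of `P₁ α` are closed subsets of `α`. -/
  closed_fst : ∀ α < lam.ord, ∀ C ∈ P₁ α, IsClosedSubset C α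
  /-- The members of `P₁ α` have order type less than `δs`. -/
  otp_fst : ∀ α < lam.ord, ∀ C ∈ P₁ α, otp C < Ordinal.lift.{u + 1} δs
  /-- Coherence of `P₁` at non-accumulation points. -/
  coherent_fst : ∀ α < lam.ord, ∀ C ∈ P₁ α, ∀ β ∈ nacc C, C ∩ Iio β ∈ P₁ β
  /-- `P₂ δ` has at most `lam` members. -/
  card_snd : ∀ δ < lam.ord, #(P₂ δ) ≤ Cardinal.lift.{u + 1} lam
  /-- The members of `P₂ δ` are clubs of `δ`. -/
  club_snd : ∀ δ < lam.ord, ∀ C ∈ P₂ δ, IsClubOf C δ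
  /-- The members of `P₂ δ` have order type `δs`. -/
  otp_snd : ∀ δ < lam.ord, ∀ C ∈ P₂ δ, otp C = Ordinal.lift.{u + 1} δs
  /-- Proper initial segments of members of `P₂ δ` at non-accumulation points are in `P₁`. -/
  coherent_snd : ∀ δ < lam.ord, ∀ C ∈ P₂ δ, ∀ β ∈ nacc C, C ∩ Iio β ∈ P₁ β
  /-- Every club of `lam` is guessed at a point of `S`. -/
  guess : ∀ E : Set Ordinal.{u}, IsClubOf E lam.ord →
    ∃ δ ∈ E ∩ S, δ.cof = δs.cof ∧ ∃ C ∈ P₂ δ, C ⊆ E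

/-!
If `lam` is the successor of a regular uncountable `μ > δs`, write each `β < lam` as the union of
an increasing continuous sequence of `μ` sets `a β i` of size less than `μ`. Projecting `a β i` to
a club `E` (each point goes to the last point of `E` below it), selecting some of the positions and
taking the closure in `β` gives fewer than `lam` candidates at `β`. If no `E` made these candidates
guess all clubs, choose for every `E` a club that is not guessed and intersect `μ` times, getting a
decreasing sequence `F ζ`, `ζ ≤ μ`. Take `δ` to be the limit of `δs` points of `F μ` and `i` such
that `a δ i` contains these points, is closed under the projection to `F μ` and satisfies
`a β i = a δ i ∩ Iio β` at each of its elements `β`. The projections of a point to the sets `F ζ`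
decrease with `ζ`, so they stabilize at its projection to `F μ`, uniformly on the small set
`a δ i`. For such a `ζ` a candidate built from `F ζ` is contained in `F μ`, hence in the club that
was not guessed at stage `ζ`: a contradiction.

A larger `lam` is reached from `τ = δs⁺⁺`. Any two normal sequences of length `τ` with the same
limit agree on a club of `τ`, so club guessing on `τ` catches, inside a club of `lam`, the image of
a guessing club under a normal sequence fixed in advance. A sequence whose points grow fast enough
makes all the initial segments of this image appear in the families in time.
-/

section Topology

section WellOrder

variable {X : Type*} [LinearOrder X] [WellFoundedLT X] [TopologicalSpace X] [OrderTopology X]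
  {s : Set X} {b x : X}

theorem isOpen_Iic_of_wellFoundedLT (x : X) : IsOpen (Iic x) := by
  by_cases hx : IsMax x
  · exact (eq_univ_of_forall fun y => hx.isTop y : Iic x = Set.univ) ▸ isOpen_univ
  · obtain ⟨y, hxy⟩ := exists_covBy_of_wellFoundedLT hx
    exact hxy.Iio_eq ▸ isOpen_Iio

theorem exists_mem_Ioc_of_mem_closure (hx : x ∈ closure s) (hb : b < x) :
    ∃ y ∈ s, b < y ∧ y ≤ x := by
  obtain ⟨y, hy, hys⟩ := mem_closure_iff.1 hx (Ioi b ∩ Iic x)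
    (isOpen_Ioi.inter (isOpen_Iic_of_wellFoundedLT x)) ⟨hb, mem_Iic.2 le_rfl⟩
  exact ⟨y, hys, hy⟩

theorem isClosed_iff_dirSupClosed : IsClosed s ↔ DirSupClosed s := by
  refine ⟨fun hs t hts ht _ x hx => hs.closure_subset_iff.2 hts (hx.mem_closure ht), fun hs => ?_⟩
  refine isClosed_of_closure_subset fun x hx => by_contra fun hxs => hxs ?_
  have nonempty : (s ∩ Iio x).Nonempty := by
    obtain ⟨y, hyx, hys⟩ := mem_closure_iff.1 hx (Iic x) (isOpen_Iic_of_wellFoundedLT x) le_rfl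
    exact ⟨y, hys, lt_of_le_of_ne hyx (ne_of_mem_of_not_mem hys hxs)⟩
  refine hs inter_subset_left nonempty (.of_linearOrder _) ⟨fun y hy => hy.2.le, fun b hb => ?_⟩
  by_contra! hbx
  obtain ⟨y, hys, hby, hyx⟩ := exists_mem_Ioc_of_mem_closure hx hbx
  exact (hb ⟨hys, lt_of_le_of_ne hyx (ne_of_mem_of_not_mem hys hxs)⟩).not_gt hby

end WellOrder

variable {x α β γ : Ordinal.{u}} {A C E s : Set Ordinal.{u}}

theorem accPt_iff_exists_between :
    AccPt x (𝓟 s) ↔ x ≠ 0 ∧ ∀ b < x, ∃ y ∈ s, b < y ∧ y < x := by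
  simp [SuccOrder.accPt_principal, Set.Nonempty]

theorem accPt_inter_Iio_iff (h : x ≤ β) : AccPt x (𝓟 (A ∩ Iio β)) ↔ AccPt x (𝓟 A) := by
  simp only [accPt_iff_exists_between, mem_inter_iff, mem_Iio]
  grind

theorem accPt_mono (h : A ⊆ C) (hx : AccPt x (𝓟 A)) : AccPt x (𝓟 C) :=
  hx.mono (Filter.principal_mono.2 h)

theorem isClosedSubset_iff :
    IsClosedSubset C α ↔ C ⊆ Iio α ∧ ∀ x < α, AccPt x (𝓟 C) → x ∈ C := by
  simp [IsClosedSubset, isClosed_iff_accPt, ← Filter.comap_principal,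
    isOpen_Iio.isOpenEmbedding_subtypeVal.accPt_comap_iff]

theorem IsClosedSubset.closure_inter_Iio_subset (hC : IsClosedSubset C α) (hA : A ⊆ C)
    (hβ : β ≤ α) : closure A ∩ Iio β ⊆ C := by
  rw [closure_eq_self_union_derivedSet]
  rintro x ⟨hx | hx, hxβ⟩
  · exact hA hx
  · exact (isClosedSubset_iff.1 hC).2 x (hxβ.trans_le hβ) (accPt_mono hA hx)

theorem isClubOf_iff :
    IsClubOf C α ↔ IsClosedSubset C α ∧ ∀ a < α, ∃ b ∈ C, a ≤ b := by
  rw [IsClubOf, IsClosedSubset, and_assoc, isClosed_iff_dirSupClosed, isClub_iff]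
  refine and_congr_right fun hC => and_congr_right fun _ => ⟨fun h a ha => ?_, fun h a => ?_⟩
  · obtain ⟨b, hb, hab⟩ := h ⟨a, ha⟩
    exact ⟨b, hb, hab⟩
  · obtain ⟨b, hb, hab⟩ := h a a.2
    exact ⟨⟨b, hC hb⟩, hb, hab⟩

theorem IsClosedSubset.inter_Iio (hC : IsClosedSubset C α) (hβ : β ≤ α) :
    IsClosedSubset (C ∩ Iio β) β := by
  rw [isClosedSubset_iff] at hC ⊢
  exact ⟨inter_subset_right, fun x hx hacc =>
    ⟨hC.2 x (hx.trans_le hβ) (accPt_mono inter_subset_left hacc), hx⟩⟩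

namespace IsClubOf

theorem isClosedSubset (hE : IsClubOf E γ) : IsClosedSubset E γ :=
  (isClubOf_iff.1 hE).1

theorem exists_ge (hE : IsClubOf E γ) : ∀ a < γ, ∃ b ∈ E, a ≤ b :=
  (isClubOf_iff.1 hE).2

theorem mem_of_accPt (hE : IsClubOf E γ) (hx : x < γ) (hacc : AccPt x (𝓟 E)) : x ∈ E :=
  (isClosedSubset_iff.1 hE.isClosedSubset).2 x hx hacc

theorem exists_gt (hE : IsClubOf E γ) (hγ : Order.IsSuccLimit γ) {a : Ordinal.{u}} (ha : a < γ) :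
    ∃ b ∈ E, a < b := by
  obtain ⟨b, hb, hab⟩ := hE.exists_ge _ (hγ.succ_lt ha)
  exact ⟨b, hb, Order.succ_le_iff.1 hab⟩

theorem accPt (hE : IsClubOf E γ) (hγ : Order.IsSuccLimit γ) : AccPt γ (𝓟 E) := by
  refine accPt_iff_exists_between.2 ⟨hγ.bot_lt.ne', fun b hb => ?_⟩
  obtain ⟨y, hy, hby⟩ := hE.exists_gt hγ hb
  exact ⟨y, hy, hby, hE.1 hy⟩

theorem diff_singleton_zero (hE : IsClubOf E γ) (hγ : Order.IsSuccLimit γ) :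
    IsClubOf (E \ {0}) γ := by
  refine isClubOf_iff.2 ⟨isClosedSubset_iff.2 ⟨sdiff_subset.trans hE.1, fun x hx hacc => ?_⟩,
    fun a ha => ?_⟩
  · exact ⟨hE.mem_of_accPt hx (accPt_mono sdiff_subset hacc), (accPt_iff_exists_between.1 hacc).1⟩
  · obtain ⟨b, hb, hab⟩ := hE.exists_gt hγ ha
    exact ⟨b, ⟨hb, (pos_of_gt hab).ne'⟩, hab.le⟩

end IsClubOf

end Topology

section OrderType

variable {b c δ δs : Ordinal.{u}} {A B C : Set Ordinal.{u}} {f : Ordinal.{u} → Ordinal.{u}}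

theorem otp_le_of_strictMonoOn (hf : StrictMonoOn f A) (hAB : MapsTo f A B) : otp A ≤ otp B :=
  Ordinal.type_le_iff'.2
    ⟨RelEmbedding.ofMonotone (fun x => ⟨f x, hAB x.2⟩) fun x y h => hf x.2 y.2 h⟩

theorem otp_mono (h : A ⊆ B) : otp A ≤ otp B :=
  otp_le_of_strictMonoOn strictMonoOn_id h

theorem otp_image (hf : StrictMonoOn f A) : otp (f '' A) = otp A :=
  (Ordinal.type_eq.2 ⟨⟨Equiv.Set.imageOfInjOn f A hf.injOn, fun {x y} =>
    hf.lt_iff_lt x.2 y.2⟩⟩).symm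

theorem otp_Iio (a : Ordinal.{u}) : otp (Iio a) = Ordinal.lift.{u + 1} a :=
  Ordinal.type_lt_Iio a

theorem Iio_inter_Iio_of_le (h : b ≤ c) : A ∩ Iio c ∩ Iio b = A ∩ Iio b := by
  rw [inter_assoc, Iio_inter_Iio, min_eq_right h]

theorem otp_inter_Iio_lt (hb : b ∈ A) : otp (A ∩ Iio b) < otp A := by
  refine lt_of_le_of_lt ?_ (Ordinal.typein_lt_type (fun x y : A => x < y) ⟨b, hb⟩)
  rw [← Ordinal.type_Iio_lt]
  exact Ordinal.type_le_iff'.2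
    ⟨RelEmbedding.ofMonotone (fun x => ⟨⟨x, x.2.1⟩, x.2.2⟩) fun x y h => h⟩

theorem strictMonoOn_otp_inter_Iio (A : Set Ordinal.{u}) :
    StrictMonoOn (fun b => otp (A ∩ Iio b)) A := fun b hb c _ hbc => by
  simpa only [Iio_inter_Iio_of_le hbc.le] using otp_inter_Iio_lt (A := A ∩ Iio c) ⟨hb, hbc⟩

theorem image_inter_Iio_of_strictMonoOn (hf : StrictMonoOn f A) (hb : b ∈ A) :
    f '' A ∩ Iio (f b) = f '' (A ∩ Iio b) := by
  ext y
  constructor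
  · rintro ⟨⟨x, hx, rfl⟩, hxb⟩
    exact ⟨x, ⟨hx, (hf.lt_iff_lt hx hb).1 hxb⟩, rfl⟩
  · rintro ⟨x, ⟨hx, hxb⟩, rfl⟩
    exact ⟨⟨x, hx, rfl⟩, hf hx hb hxb⟩

theorem exists_strictMonoOn_image_eq (h : otp A = otp B) :
    ∃ f : Ordinal.{u} → Ordinal.{u}, StrictMonoOn f A ∧ f '' A = B := by
  obtain ⟨φ⟩ := Ordinal.type_eq.1 h
  let f : Ordinal.{u} → Ordinal.{u} := Function.extend Subtype.val (fun x : A => (φ x).1) 0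
  have f_val (x : A) : f x = φ x := Subtype.val_injective.extend_apply _ _ x
  refine ⟨f, fun x hx y hy hxy => ?_, ?_⟩
  · rw [f_val ⟨x, hx⟩, f_val ⟨y, hy⟩]
    exact φ.map_rel_iff.2 (show (⟨x, hx⟩ : A) < ⟨y, hy⟩ from hxy)
  · rw [image_eq_range]
    simp only [f_val]
    exact (φ.surjective.range_comp Subtype.val).trans Subtype.range_coe

theorem exists_lift_eq_otp {μ : Cardinal.{u}} (hB : #B < Cardinal.lift.{u + 1} μ) :
    ∃ η < μ.ord, Ordinal.lift.{u + 1} η = otp B := by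
  refine Ordinal.lt_lift_iff.1 ?_
  rw [Cardinal.lift_ord, Cardinal.lt_ord]
  exact hB

theorem cof_eq_of_isClubOf (hC : IsClubOf C δ) (h : otp C = Ordinal.lift.{u + 1} δs) :
    δ.cof = δs.cof := by
  have cofinal : Order.cof (Subtype.val ⁻¹' C : Set (Iio δ)) = Order.cof (Iio δ) :=
    cof_eq_of_isCofinal hC.2.isCofinal
  have type_eq : typeLT (Subtype.val ⁻¹' C : Set (Iio δ)) = otp C :=
    Ordinal.type_eq.2 ⟨⟨fun x => ⟨x.1, x.2⟩, fun x => ⟨⟨x, hC.1 x.2⟩, x.2⟩,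
      fun _ => rfl, fun _ => rfl⟩, Iff.rfl⟩
  rw [← cof_type, type_eq, h, cof_Iio, ← lift_cof, ← lift_cof] at cofinal
  exact (Cardinal.lift_injective cofinal).symm

end OrderType

section Closure

variable {x β γ : Ordinal.{u}} {D : Set Ordinal.{u}}

theorem closure_inter_Iio_inter_Iio (h : γ ≤ β) :
    closure D ∩ Iio β ∩ Iio γ = closure (D ∩ Iio γ) ∩ Iio γ := by
  rw [Iio_inter_Iio_of_le h]
  refine Subset.antisymm (fun x hx => ⟨isOpen_Iio.closure_inter hx, hx.2⟩) ?_
  exact inter_subset_inter_left _ (closure_mono inter_subset_left)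

theorem nacc_closure_inter_Iio_subset : nacc (closure D ∩ Iio β) ⊆ D := by
  rintro x ⟨⟨hx, hxβ⟩, hacc⟩
  rw [closure_eq_self_union_derivedSet] at hx
  refine hx.resolve_right fun hxD => hacc ?_
  exact (accPt_inter_Iio_iff (le_of_lt hxβ)).2 (accPt_mono subset_closure hxD)

theorem isClubOf_closure_inter_Iio (hD : D ⊆ Iio β) (hcof : ∀ a < β, ∃ b ∈ D, a < b) :
    IsClubOf (closure D ∩ Iio β) β := by
  refine isClubOf_iff.2 ⟨isClosedSubset_iff.2 ⟨inter_subset_right, fun x hx hacc => ⟨?_, hx⟩⟩,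
    fun a ha => ?_⟩
  · exact isClosed_closure.closure_subset_iff.2 inter_subset_left (mem_closure_iff_clusterPt.2
      hacc.clusterPt)
  · obtain ⟨b, hb, hab⟩ := hcof a ha
    exact ⟨b, ⟨subset_closure hb, hD hb⟩, hab.le⟩

theorem otp_closure_inter_Iio (hD : D ⊆ Iio β) (hcof : ∀ a < β, ∃ b ∈ D, a < b) :
    otp (closure D ∩ Iio β) = otp D := by
  refine le_antisymm ?_ (otp_mono fun x hx => ⟨subset_closure hx, hD hx⟩)
  have next_mem : ∀ x < β, sInf (D ∩ Ioi x) ∈ D ∩ Ioi x := fun x hx => csInf_mem (hcof x hx)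
  refine otp_le_of_strictMonoOn (f := fun x => sInf (D ∩ Ioi x)) (fun x _ y hy hxy => ?_)
    fun x hx => (next_mem x hx.2).1
  obtain ⟨d, hd, hxd, hdy⟩ := exists_mem_Ioc_of_mem_closure hy.1 hxy
  exact (csInf_le' (show d ∈ D ∩ Ioi x from ⟨hd, hxd⟩)).trans_lt
    (hdy.trans_lt (next_mem y hy.2).2)

end Closure

section Pruning

variable {lam : Cardinal.{u}} {α β γ δ δs : Ordinal.{u}} {C E : Set Ordinal.{u}}
  {R : Ordinal.{u} → Set (Set Ordinal.{u})} {W : Set (Set Ordinal.{u})}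

/-- `C` is a club of `δ` of order type `δs` whose initial segments at the points of `nacc C` all
belong to the system `R`: these are the clubs that may be put in the family `𝒫*₂` at `δ`. -/
structure IsCoherentClub (R : Ordinal.{u} → Set (Set Ordinal.{u})) (δs : Ordinal.{u})
    (C : Set Ordinal.{u}) (δ : Ordinal.{u}) : Prop where
  isClubOf : IsClubOf C δ
  otp_eq : otp C = Ordinal.lift.{u + 1} δs
  coherent : ∀ β ∈ nacc C, C ∩ Iio β ∈ R β

/-- A weak form of club guessing below `lam`: the sets in `R α` are arbitrary, and the guessing
clubs are collected in one family `W` instead of being listed point by point. -/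
structure IsGuessingScheme (lam : Cardinal.{u}) (δs : Ordinal.{u})
    (R : Ordinal.{u} → Set (Set Ordinal.{u})) (W : Set (Set Ordinal.{u})) : Prop where
  card_lt : ∀ α < lam.ord, #(R α) < Cardinal.lift.{u + 1} lam
  card_le : #W ≤ Cardinal.lift.{u + 1} lam
  guess : ∀ E, IsClubOf E lam.ord →
    ∃ C ∈ W, ∃ δ < lam.ord, IsCoherentClub R δs C δ ∧ C ⊆ E

/-- The members of `R α` that may be put in the family `𝒫*₁` at `α`. -/
def coherentPart (R : Ordinal.{u} → Set (Set Ordinal.{u})) (δs α : Ordinal.{u}) :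
    Set (Set Ordinal.{u}) :=
  {C ∈ R α | IsClosedSubset C α ∧ otp C < Ordinal.lift.{u + 1} δs ∧
    ∀ β ∈ nacc C, C ∩ Iio β ∈ R β}

theorem mem_nacc_of_mem_nacc_inter_Iio (hγ : γ ∈ nacc (C ∩ Iio β)) : γ ∈ nacc C :=
  ⟨hγ.1.1, fun hacc => hγ.2 ((accPt_inter_Iio_iff (le_of_lt hγ.1.2)).2 hacc)⟩

theorem inter_Iio_mem_coherentPart (hC : IsClosedSubset C α)
    (hotp : otp C ≤ Ordinal.lift.{u + 1} δs)
    (hR : ∀ β ∈ nacc C, C ∩ Iio β ∈ R β) (hβ : β ∈ nacc C) :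
    C ∩ Iio β ∈ coherentPart R δs β := by
  refine ⟨hR β hβ, hC.inter_Iio (le_of_lt (hC.1 hβ.1)), (otp_inter_Iio_lt hβ.1).trans_le hotp,
    fun γ hγ => ?_⟩
  rw [Iio_inter_Iio_of_le (le_of_lt hγ.1.2)]
  exact hR γ (mem_nacc_of_mem_nacc_inter_Iio hγ)

namespace IsCoherentClub

theorem cof_eq (hC : IsCoherentClub R δs C δ) : δ.cof = δs.cof :=
  cof_eq_of_isClubOf hC.isClubOf hC.otp_eq

theorem isSuccLimit (hC : IsCoherentClub R δs C δ) (hδs : Order.IsSuccLimit δs) :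
    Order.IsSuccLimit δ := by
  rwa [← one_lt_cof_iff, hC.cof_eq, one_lt_cof_iff]

theorem mem_of_subset (hC : IsCoherentClub R δs C δ) (hδs : Order.IsSuccLimit δs)
    (hE : IsClubOf E γ) (hδ : δ < γ) (hCE : C ⊆ E) : δ ∈ E :=
  hE.mem_of_accPt hδ (accPt_mono hCE (hC.isClubOf.accPt (hC.isSuccLimit hδs)))

end IsCoherentClub

namespace IsGuessingScheme

theorem isStationaryIn (h : IsGuessingScheme lam δs R W) (hδs : Order.IsSuccLimit δs) :
    IsStationaryIn {δ | δ < lam.ord ∧ δ.cof = δs.cof} lam.ord := by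
  refine ⟨fun δ hδ => hδ.1, fun t ht => ?_⟩
  have isClubOf_image : IsClubOf (Subtype.val '' t) lam.ord :=
    ⟨by rintro _ ⟨x, -, rfl⟩; exact x.2, by rwa [preimage_image_eq _ Subtype.val_injective]⟩
  obtain ⟨C, -, δ, hδ, hC, hCE⟩ := h.guess _ isClubOf_image
  obtain ⟨x, hx, rfl⟩ := hC.mem_of_subset hδs isClubOf_image hδ hCE
  exact ⟨x, ⟨hδ, hC.cof_eq⟩, hx⟩

theorem guessingFamilies (h : IsGuessingScheme lam δs R W) (hδs : Order.IsSuccLimit δs) :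
    GuessingFamilies lam δs {δ | δ < lam.ord ∧ δ.cof = δs.cof} (coherentPart R δs)
      (fun δ => {C ∈ W | IsCoherentClub R δs C δ}) where
  card_fst α hα := (mk_le_mk_of_subset (sep_subset _ _)).trans_lt (h.card_lt α hα)
  closed_fst _ _ _ hC := hC.2.1
  otp_fst _ _ _ hC := hC.2.2.1
  coherent_fst _ _ _ hC _ hβ := inter_Iio_mem_coherentPart hC.2.1 hC.2.2.1.le hC.2.2.2 hβ
  card_snd _ _ := (mk_le_mk_of_subset (sep_subset _ _)).trans h.card_le
  club_snd _ _ _ hC := hC.2.isClubOf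
  otp_snd _ _ _ hC := hC.2.otp_eq
  coherent_snd _ _ _ hC _ hβ :=
    inter_Iio_mem_coherentPart hC.2.isClubOf.isClosedSubset hC.2.otp_eq.le hC.2.coherent hβ
  guess E hE := by
    obtain ⟨C, hCW, δ, hδ, hC, hCE⟩ := h.guess E hE
    exact ⟨δ, ⟨hC.mem_of_subset hδs hE hδ hCE, hδ, hC.cof_eq⟩, hC.cof_eq, C, ⟨hCW, hC⟩, hCE⟩

end IsGuessingScheme

end Pruning

section Cofinality

variable {μ : Cardinal.{u}} {ζ θ : Ordinal.{u}}

theorem exists_gt_of_mk_lt_cof {A : Set Ordinal.{u}} (hA : #A < Cardinal.lift.{u + 1} θ.cof)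
    (hlt : ∀ x ∈ A, x < θ) : ∃ b < θ, ∀ x ∈ A, x < b := by
  refine ⟨sSup ((· + 1) '' A), sSup_add_one_lt_of_lt_cof (by rwa [← lift_cof]) hlt, fun x hx => ?_⟩
  refine (lt_add_one x).trans_le (le_csSup ⟨θ, ?_⟩ (mem_image_of_mem _ hx))
  rintro _ ⟨y, hy, rfl⟩
  exact Order.add_one_le_of_lt (hlt y hy)

theorem exists_uniform_of_mk_lt_cof {X : Type (u + 1)} {A : Set X} {p : X → Ordinal.{u} → Prop}
    (hA : #A < Cardinal.lift.{u + 1} θ.cof) (hp : ∀ x ∈ A, Monotone (p x))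
    (h : ∀ x ∈ A, ∃ j < θ, p x j) : ∃ j < θ, ∀ x ∈ A, p x j := by
  choose! g hgθ hpg using h
  obtain ⟨j, hj, hgj⟩ := exists_gt_of_mk_lt_cof (A := g '' A) (mk_image_le.trans_lt hA)
    (forall_mem_image.2 hgθ)
  exact ⟨j, hj, fun x hx => hp x hx (hgj _ (mem_image_of_mem g hx)).le (hpg x hx)⟩

theorem mk_Iio_lt_lift (hζ : ζ < μ.ord) : #(Iio ζ) < Cardinal.lift.{u + 1} μ := by
  rw [Cardinal.mk_Iio_ordinal]
  exact Cardinal.lift_lt.2 (Cardinal.lt_ord.1 hζ)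

theorem mk_Iio_ord (μ : Cardinal.{u}) : #(Iio μ.ord) = Cardinal.lift.{u + 1} μ := by
  rw [Cardinal.mk_Iio_ordinal, card_ord]

theorem isClubOf_forall_lt (hθ : ℵ₀ < θ.cof) (hζ : ζ.card < θ.cof)
    {F : Ordinal.{u} → Set Ordinal.{u}} (hF : ∀ ξ < ζ, IsClubOf (F ξ) θ) :
    IsClubOf {x | x < θ ∧ ∀ ξ < ζ, x ∈ F ξ} θ := by
  have cof_Iio_eq : Order.cof (Iio θ) = Cardinal.lift.{u + 1} θ.cof := by rw [cof_Iio, ← lift_cof]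
  have preimage_eq : (Subtype.val ⁻¹' {x | x < θ ∧ ∀ ξ < ζ, x ∈ F ξ} : Set (Iio θ)) =
      ⋂₀ ((fun ξ => Subtype.val ⁻¹' F ξ) '' Iio ζ) := by
    ext x
    simp [mem_Iio.1 x.2]
  refine ⟨fun x hx => hx.1, preimage_eq ▸ IsClub.sInter ?_ ?_ (forall_mem_image.2 fun ξ hξ =>
    (hF ξ hξ).2)⟩
  · rw [cof_Iio_eq]
    exact (Cardinal.aleph0_lt_lift.2 hθ).ne'
  · rw [cof_Iio_eq]
    refine mk_image_le.trans_lt ?_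
    rw [Cardinal.mk_Iio_ordinal]
    exact Cardinal.lift_lt.2 hζ

theorem exists_closure_point (hμ : μ.IsRegular) (hunc : ℵ₀ < μ)
    {r : Ordinal.{u} → Ordinal.{u} → Prop} (h : ∀ k < μ.ord, ∃ m < μ.ord, r k m)
    {i₀ : Ordinal.{u}} (hi₀ : i₀ < μ.ord) :
    ∃ i < μ.ord, i₀ < i ∧ Order.IsSuccLimit i ∧ ∀ k < i, ∃ m < i, r k m := by
  have step : ∀ i < μ.ord, ∃ j < μ.ord, i < j ∧ ∀ k < i, ∃ m < j, r k m := by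
    intro i hi
    obtain ⟨j, hj, hij⟩ := exists_uniform_of_mk_lt_cof (A := Iio i) (θ := μ.ord)
      (p := fun k j => ∃ m < j, r k m) (hμ.cof_ord.symm ▸ mk_Iio_lt_lift hi)
      (fun k _ j j' hj ⟨m, hm, hkm⟩ => ⟨m, hm.trans_le hj, hkm⟩) fun k hk => by
        obtain ⟨m, hm, hkm⟩ := h k (lt_trans hk hi)
        exact ⟨_, (isSuccLimit_ord hμ.aleph0_le).succ_lt hm, m, Order.lt_succ m, hkm⟩
    refine ⟨max (Order.succ i) j, max_lt ((isSuccLimit_ord hμ.aleph0_le).succ_lt hi) hj,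
      (Order.lt_succ i).trans_le (le_max_left _ _), fun k hk => ?_⟩
    exact (hij k hk).imp fun m hm => ⟨hm.1.trans_le (le_max_right _ _), hm.2⟩
  choose! g hg_lt lt_g hg using step
  let s : ℕ → Ordinal.{u} := fun n => g^[n] i₀
  have s_succ (n : ℕ) : s (n + 1) = g (s n) := Function.iterate_succ_apply' g n i₀
  have s_lt (n : ℕ) : s n < μ.ord := by
    induction n with
    | zero => exact hi₀
    | succ n ih => exact s_succ n ▸ hg_lt _ ih
  have s_lt_iSup (n : ℕ) : s n < ⨆ n, s n :=
    (s_succ n ▸ lt_g _ (s_lt n) : s n < s (n + 1)).trans_le (Ordinal.le_iSup s (n + 1))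
  refine ⟨⨆ n, s n, Ordinal.lift_iSup_lt_of_lt_cof (by simpa [hμ.cof_ord] using hunc) s_lt,
    s_lt_iSup 0, (accPt_iff_exists_between (s := range s)).2 ⟨(pos_of_gt (s_lt_iSup 0)).ne',
      fun b hb => ?_⟩ |>.isSuccLimit, fun k hk => ?_⟩
  · obtain ⟨n, hn⟩ := Ordinal.lt_iSup_iff.1 hb
    exact ⟨s n, mem_range_self n, hn, s_lt_iSup n⟩
  · obtain ⟨n, hn⟩ := Ordinal.lt_iSup_iff.1 hk
    obtain ⟨m, hm, hkm⟩ := hg _ (s_lt n) k hn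
    exact ⟨m, (s_succ n ▸ hm).trans (s_lt_iSup (n + 1)), hkm⟩

end Cofinality

section NormalSequence

theorem le_apply_of_strictMonoOn_Iio {f : Ordinal.{u} → Ordinal.{u}} {i τ : Ordinal.{u}}
    (hf : StrictMonoOn f (Iio τ)) (hi : i < τ) : i ≤ f i := by
  induction i using WellFoundedLT.induction with
  | ind i ih =>
    exact le_of_forall_lt fun k hk => (ih k hk (hk.trans hi)).trans_lt (hf (hk.trans hi) hi hk)

/-- `e` enumerates, increasingly and continuously along the ordinals below `τ`, a cofinal subset
of `δ`. It is a normal function whose domain is cut down to `τ`. -/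
structure IsNormalBelow (e : Ordinal.{u} → Ordinal.{u}) (τ δ : Ordinal.{u}) : Prop where
  strictMonoOn : StrictMonoOn e (Iio τ)
  continuous : ∀ i < τ, Order.IsSuccLimit i → ∀ b < e i, ∃ k < i, b < e k
  lt : ∀ i < τ, e i < δ
  cofinal : ∀ b < δ, ∃ i < τ, b < e i

namespace IsNormalBelow

variable {a e : Ordinal.{u} → Ordinal.{u}} {i j x δ δ' τ : Ordinal.{u}} {c : Set Ordinal.{u}}
  {μ : Cardinal.{u}}

theorem mono (h : IsNormalBelow e τ δ) (hi : i < τ) (hlim : Order.IsSuccLimit i) :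
    IsNormalBelow e i (e i) where
  strictMonoOn := h.strictMonoOn.mono (Iio_subset_Iio hi.le)
  continuous j hj := h.continuous j (hj.trans hi)
  lt _ hj := h.strictMonoOn (hj.trans hi) hi hj
  cofinal := h.continuous i hi hlim

theorem accPt_image (h : IsNormalBelow e τ δ) (hj : j < τ) (hacc : AccPt j (𝓟 c)) :
    AccPt (e j) (𝓟 (e '' c)) := by
  obtain ⟨hj0, hbetween⟩ := accPt_iff_exists_between.1 hacc
  have e_lt {k l : Ordinal.{u}} (hkl : k < l) (hl : l ≤ j) : e k < e l :=
    h.strictMonoOn (hkl.trans_le (hl.trans hj.le)) (hl.trans_lt hj) hkl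
  refine accPt_iff_exists_between.2
    ⟨(pos_of_gt (e_lt (pos_iff_ne_zero.2 hj0) le_rfl)).ne', fun b hb => ?_⟩
  obtain ⟨k, hk, hbk⟩ := h.continuous j hj hacc.isSuccLimit b hb
  obtain ⟨y, hy, hky, hyj⟩ := hbetween k hk
  exact ⟨e y, mem_image_of_mem e hy, hbk.trans (e_lt hky hyj.le), e_lt hyj le_rfl⟩

theorem exists_eq_of_accPt_image (h : IsNormalBelow e τ δ) (hc : c ⊆ Iio τ) (hx : x < δ)
    (hacc : AccPt x (𝓟 (e '' c))) : ∃ j < τ, AccPt j (𝓟 c) ∧ e j = x := by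
  obtain ⟨hx0, hbetween⟩ := accPt_iff_exists_between.1 hacc
  obtain ⟨k, hk, hxk⟩ := h.cofinal x hx
  let j := sInf {j | x ≤ e j}
  have x_le : x ≤ e j := csInf_mem (s := {j | x ≤ e j}) ⟨k, hxk.le⟩
  have lt_x (b : Ordinal.{u}) (hb : b < j) : e b < x :=
    not_le.1 fun hle => not_le.2 hb (csInf_le' hle)
  have hj : j < τ := (csInf_le' (show k ∈ {j | x ≤ e j} from hxk.le)).trans_lt hk
  have lt_j (y : Ordinal.{u}) (hy : y ∈ c) (hyx : e y < x) : y < j :=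
    (h.strictMonoOn.lt_iff_lt (hc hy) hj).1 (hyx.trans_le x_le)
  have accPt_j : AccPt j (𝓟 c) := by
    refine accPt_iff_exists_between.2 ⟨?_, fun b hb => ?_⟩
    · obtain ⟨_, ⟨y, hy, rfl⟩, -, hyx⟩ := hbetween 0 (pos_iff_ne_zero.2 hx0)
      exact (pos_of_gt (lt_j y hy hyx)).ne'
    · obtain ⟨_, ⟨y, hy, rfl⟩, hby, hyx⟩ := hbetween _ (lt_x b hb)
      exact ⟨y, hy, (h.strictMonoOn.lt_iff_lt (hb.trans hj) (hc hy)).1 hby, lt_j y hy hyx⟩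
  refine ⟨j, hj, accPt_j, x_le.antisymm' (le_of_not_gt fun hlt => ?_)⟩
  obtain ⟨m, hm, hxm⟩ := h.continuous j hj accPt_j.isSuccLimit x hlt
  exact lt_asymm hxm (lt_x m hm)

theorem isClubOf_image (h : IsNormalBelow e τ δ) (hc : IsClubOf c τ) : IsClubOf (e '' c) δ := by
  refine isClubOf_iff.2 ⟨isClosedSubset_iff.2 ⟨image_subset_iff.2 fun j hj => h.lt j (hc.1 hj),
    fun x hx hacc => ?_⟩, fun b hb => ?_⟩
  · obtain ⟨j, hj, hjacc, rfl⟩ := h.exists_eq_of_accPt_image hc.1 hx hacc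
    exact mem_image_of_mem e (hc.mem_of_accPt hj hjacc)
  · obtain ⟨k, hk, hbk⟩ := h.cofinal b hb
    obtain ⟨y, hy, hky⟩ := hc.exists_ge k hk
    exact ⟨e y, mem_image_of_mem e hy, hbk.le.trans (h.strictMonoOn.monotoneOn hk (hc.1 hy) hky)⟩

theorem le_of_forall_exists_lt (he : IsNormalBelow e τ δ) (ha : IsNormalBelow a τ δ')
    (hi : i < τ) (hlim : Order.IsSuccLimit i) (h : ∀ k < i, ∃ m < i, e k < a m) : e i ≤ a i := by
  by_contra! hlt
  obtain ⟨k, hk, hak⟩ := he.continuous i hi hlim _ hlt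
  obtain ⟨m, hm, hkm⟩ := h k hk
  exact lt_asymm (hak.trans hkm) (ha.strictMonoOn (hm.trans hi) hi hm)

theorem eq_of_forall_exists_lt (he : IsNormalBelow e τ δ) (ha : IsNormalBelow a τ δ')
    (hi : i < τ) (hlim : Order.IsSuccLimit i) (h : ∀ k < i, ∃ m < i, e k < a m ∧ a k < e m) :
    e i = a i :=
  le_antisymm
    (he.le_of_forall_exists_lt ha hi hlim fun k hk => (h k hk).imp fun _ hm => ⟨hm.1, hm.2.1⟩)
    (ha.le_of_forall_exists_lt he hi hlim fun k hk => (h k hk).imp fun _ hm => ⟨hm.1, hm.2.2⟩)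

theorem isClubOf_eq (hμ : μ.IsRegular) (hunc : ℵ₀ < μ) (he : IsNormalBelow e μ.ord δ)
    (ha : IsNormalBelow a μ.ord δ) :
    IsClubOf {i | i < μ.ord ∧ Order.IsSuccLimit i ∧ e i = a i} μ.ord := by
  refine isClubOf_iff.2 ⟨isClosedSubset_iff.2 ⟨fun i hi => hi.1, fun x hx hacc => ?_⟩,
    fun i₀ hi₀ => ?_⟩
  · refine ⟨hx, hacc.isSuccLimit, he.eq_of_forall_exists_lt ha hx hacc.isSuccLimit fun k hk => ?_⟩
    obtain ⟨y, ⟨hy, -, heq⟩, hky, hyx⟩ := (accPt_iff_exists_between.1 hacc).2 k hk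
    exact ⟨y, hyx, heq ▸ he.strictMonoOn (hky.trans hy) hy hky,
      heq ▸ ha.strictMonoOn (hky.trans hy) hy hky⟩
  · have interleaved : ∀ k < μ.ord, ∃ m < μ.ord, e k < a m ∧ a k < e m := by
      intro k hk
      obtain ⟨m₁, hm₁, hkm₁⟩ := ha.cofinal _ (he.lt k hk)
      obtain ⟨m₂, hm₂, hkm₂⟩ := he.cofinal _ (ha.lt k hk)
      have hmax : max m₁ m₂ < μ.ord := max_lt hm₁ hm₂
      exact ⟨max m₁ m₂, hmax,
        hkm₁.trans_le (ha.strictMonoOn.monotoneOn hm₁ hmax (le_max_left _ _)),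
        hkm₂.trans_le (he.strictMonoOn.monotoneOn hm₂ hmax (le_max_right _ _))⟩
    obtain ⟨i, hi, hi₀i, hlim, hclosed⟩ := exists_closure_point hμ hunc interleaved hi₀
    exact ⟨i, ⟨hi, hlim, he.eq_of_forall_exists_lt ha hi hlim hclosed⟩, hi₀i.le⟩

end IsNormalBelow

variable {lam : Cardinal.{u}} {i : Ordinal.{u}} {E : Set Ordinal.{u}}
  {H : (k : Ordinal.{u}) → (Iio k → Ordinal.{u}) → Ordinal.{u}}

/-- The greedy increasing sequence of points of `E` whose `i`-th term also exceeds, for every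
`k < i`, the bound `H k` computed from the terms with index below `k`. -/
noncomputable def sparseEnum (E : Set Ordinal.{u})
    (H : (k : Ordinal.{u}) → (Iio k → Ordinal.{u}) → Ordinal.{u}) (i : Ordinal.{u}) :
    Ordinal.{u} :=
  sInf {x ∈ E | ∀ k, ∀ _ : k < i,
    sparseEnum E H k < x ∧ H k (fun y => sparseEnum E H y) < x}
termination_by i
decreasing_by
  · assumption
  · exact lt_trans y.2 ‹_›

theorem sparseEnum_mem (hlam : lam.IsRegular) (hE : IsClubOf E lam.ord)
    (hH : ∀ k < lam.ord, ∀ x, H k x < lam.ord) (hi : i < lam.ord) :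
    sparseEnum E H i ∈ {x ∈ E | ∀ k < i,
      sparseEnum E H k < x ∧ H k (fun y => sparseEnum E H y) < x} := by
  induction i using WellFoundedLT.induction with
  | ind i ih =>
    obtain ⟨b, hb, hlt_b⟩ := exists_gt_of_mk_lt_cof
      (A := (fun k => max (sparseEnum E H k) (H k fun y => sparseEnum E H y)) '' Iio i)
      (mk_image_le.trans_lt (hlam.cof_ord.symm ▸ mk_Iio_lt_lift hi))
      (forall_mem_image.2 fun k hk =>
        max_lt (hE.1 (ih k hk (lt_trans hk hi)).1) (hH k (lt_trans hk hi) _))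
    obtain ⟨x, hx, hbx⟩ := hE.exists_ge b hb
    rw [sparseEnum]
    exact csInf_mem ⟨x, hx, fun k hk =>
      max_lt_iff.1 ((hlt_b _ (mem_image_of_mem _ hk)).trans_le hbx)⟩

theorem exists_lt_sparseEnum (hlam : lam.IsRegular) (hE : IsClubOf E lam.ord)
    (hH : ∀ k < lam.ord, ∀ x, H k x < lam.ord) (hi : i < lam.ord) (hlim : Order.IsSuccLimit i)
    {b : Ordinal.{u}} (hb : b < sparseEnum E H i) : ∃ k < i, b < sparseEnum E H k := by
  have mem {k : Ordinal.{u}} (hk : k < i) := sparseEnum_mem hlam hE hH (hk.trans hi)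
  by_contra! hcon
  let s := sSup (sparseEnum E H '' Iio i)
  have le_s {k : Ordinal.{u}} (hk : k < i) : sparseEnum E H k ≤ s :=
    le_csSup ⟨b, forall_mem_image.2 hcon⟩ (mem_image_of_mem _ hk)
  have s_lt : s < sparseEnum E H i := (csSup_le' (forall_mem_image.2 hcon)).trans_lt hb
  have lt_s {k : Ordinal.{u}} (hk : k < i) :
      sparseEnum E H k < s ∧ H k (fun y => sparseEnum E H y) < s :=
    ((mem (hlim.succ_lt hk)).2 k (Order.lt_succ k)).imp (·.trans_le (le_s (hlim.succ_lt hk)))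
      (·.trans_le (le_s (hlim.succ_lt hk)))
  have s_mem : s ∈ E := by
    refine hE.mem_of_accPt (s_lt.trans (hE.1 (sparseEnum_mem hlam hE hH hi).1))
      (accPt_iff_exists_between.2 ⟨(pos_of_gt (lt_s hlim.bot_lt).1).ne', fun d hd => ?_⟩)
    obtain ⟨_, ⟨k, hk, rfl⟩, hdk⟩ := exists_lt_of_lt_csSup' hd
    exact ⟨_, (mem hk).1, hdk, (lt_s hk).1⟩
  refine s_lt.not_ge ?_
  rw [sparseEnum]
  exact csInf_le' ⟨s_mem, fun k hk => lt_s hk⟩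

theorem isNormalBelow_sparseEnum (hlam : lam.IsRegular) (hE : IsClubOf E lam.ord)
    (hH : ∀ k < lam.ord, ∀ x, H k x < lam.ord) :
    IsNormalBelow (sparseEnum E H) lam.ord lam.ord := by
  have strictMonoOn : StrictMonoOn (sparseEnum E H) (Iio lam.ord) := fun k _ i hi hki =>
    ((sparseEnum_mem hlam hE hH hi).2 k hki).1
  refine ⟨strictMonoOn, fun i hi hlim b hb => exists_lt_sparseEnum hlam hE hH hi hlim hb,
    fun i hi => hE.1 (sparseEnum_mem hlam hE hH hi).1, fun b hb => ?_⟩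
  have hsucc := (isSuccLimit_ord hlam.aleph0_le).succ_lt hb
  exact ⟨_, hsucc, Order.succ_le_iff.1 (le_apply_of_strictMonoOn_Iio strictMonoOn hsucc)⟩

end NormalSequence

section Transfer

variable {lam τ : Cardinal.{u}} {β δ δs : Ordinal.{u}} {a : Ordinal.{u} → Ordinal.{u}}
  {c E : Set Ordinal.{u}} {Q : Set (Set Ordinal.{u})} {R : Ordinal.{u} → Set (Set Ordinal.{u})}

theorem exists_isNormalBelow_capturing (hlam : lam.IsRegular) (hE : IsClubOf E lam.ord)
    (hQ : #Q < Cardinal.lift.{u + 1} lam) (hR : Monotone R) :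
    ∃ a : Ordinal.{u} → Ordinal.{u}, IsNormalBelow a lam.ord lam.ord ∧ MapsTo a (Iio lam.ord) E ∧
      ∀ i < lam.ord, ∀ j < i, ∀ c ∈ Q, ∀ β < lam.ord,
        a '' (c ∩ Iio j) ∈ R β → a '' (c ∩ Iio j) ∈ R (a i) := by
  have bound (k : Ordinal.{u}) (x : Iio k → Ordinal.{u}) : ∃ h < lam.ord, ∀ c ∈ Q,
      (∃ β < lam.ord, x '' (Subtype.val ⁻¹' c) ∈ R β) → x '' (Subtype.val ⁻¹' c) ∈ R h := by
    refine exists_uniform_of_mk_lt_cof (hlam.cof_ord.symm ▸ hQ)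
      (fun c _ j j' hj h hβ => hR hj (h hβ)) fun c _ => ?_
    by_cases hc : ∃ β < lam.ord, x '' (Subtype.val ⁻¹' c) ∈ R β
    · obtain ⟨β, hβ, hxR⟩ := hc
      exact ⟨β, hβ, fun _ => hxR⟩
    · exact ⟨0, (isSuccLimit_ord hlam.aleph0_le).bot_lt, fun h => absurd h hc⟩
  choose H H_lt hH using bound
  refine ⟨sparseEnum E H, isNormalBelow_sparseEnum hlam hE fun k _ => H_lt k,
    fun i hi => (sparseEnum_mem hlam hE (fun k _ => H_lt k) hi).1,
    fun i hi j hj c hc β hβ hcR => ?_⟩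
  have image_eq : (fun y : Iio j => sparseEnum E H y) '' (Subtype.val ⁻¹' c) =
      sparseEnum E H '' (c ∩ Iio j) := by
    rw [← Function.comp_def, image_comp, Subtype.image_preimage_coe, inter_comm]
  refine hR ((sparseEnum_mem hlam hE (fun k _ => H_lt k) hi).2 j hj).2.le ?_
  rw [← image_eq] at hcR ⊢
  exact hH j _ c hc ⟨β, hβ, hcR⟩

theorem IsNormalBelow.exists_lt_of_mem_nacc_image {τ : Ordinal.{u}} (h : IsNormalBelow a τ δ)
    (hc : c ⊆ Iio τ) (hlim : ∀ j ∈ c, Order.IsSuccLimit j) (hβ : β ∈ nacc (a '' c)) :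
    ∃ j ∈ c, ∃ m < j, a j = β ∧ a '' c ∩ Iio β = a '' (c ∩ Iio m) := by
  obtain ⟨⟨j, hj, rfl⟩, hacc⟩ := hβ
  have not_accPt : ¬ AccPt j (𝓟 c) := fun hjacc => hacc (h.accPt_image (hc hj) hjacc)
  rw [accPt_iff_exists_between] at not_accPt
  push Not at not_accPt
  obtain ⟨k, hk, le_of_gt⟩ := not_accPt (hlim j hj).bot_lt.ne'
  refine ⟨j, hj, Order.succ k, (hlim j hj).succ_lt hk, rfl, ?_⟩
  rw [image_inter_Iio_of_strictMonoOn (h.strictMonoOn.mono hc) hj]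
  congr 1
  ext y
  refine and_congr_right fun hy => ⟨fun hyj => mem_Iio.2 (Order.lt_succ_iff.2 ?_),
    fun hyk => ?_⟩
  · exact le_of_not_gt fun hky => not_le.2 hyj (le_of_gt y hy hky)
  · exact (Order.lt_succ_iff.1 hyk).trans_lt hk

/-- A chosen normal sequence of length `τ` with limit `δ`, arbitrary when there is none. -/
noncomputable def normalSeq (τ δ : Ordinal.{u}) : Ordinal.{u} → Ordinal.{u} :=
  Classical.epsilon fun e => IsNormalBelow e τ δ

theorem isNormalBelow_normalSeq {τ : Ordinal.{u}} (h : IsNormalBelow a τ δ) :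
    IsNormalBelow (normalSeq τ δ) τ δ :=
  Classical.epsilon_spec (p := fun e => IsNormalBelow e τ δ) ⟨a, h⟩

/-- The images of the initial segments of members of `Q` under the chosen normal sequences of
length `τ` with limit at most `β`. -/
def transferSystem (τ : Ordinal.{u}) (Q : Set (Set Ordinal.{u})) (β : Ordinal.{u}) :
    Set (Set Ordinal.{u}) :=
  image2 (fun δ x => normalSeq τ δ '' x) (Iic β) (image2 (fun c j => c ∩ Iio j) Q (Iio τ))

theorem monotone_transferSystem (τ : Ordinal.{u}) (Q : Set (Set Ordinal.{u})) :
    Monotone (transferSystem τ Q) := fun _ _ h =>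
  image2_subset_right (Iic_subset_Iic.2 h)

theorem mk_transferSystem_lt (hlam : ℵ₀ ≤ lam) (hτ : τ < lam)
    (hQ : #Q < Cardinal.lift.{u + 1} lam) (hβ : β < lam.ord) :
    #(transferSystem τ.ord Q β) < Cardinal.lift.{u + 1} lam := by
  have hlift := Cardinal.aleph0_le_lift.2 hlam
  refine mk_image2_le.trans_lt (mul_lt_of_lt hlift ?_ (mk_image2_le.trans_lt
    (mul_lt_of_lt hlift hQ (mk_Iio_lt_lift (ord_lt_ord.2 hτ)))))
  rw [← Order.Iio_succ]
  exact mk_Iio_lt_lift ((isSuccLimit_ord hlam).succ_lt hβ)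

theorem IsNormalBelow.isCoherentClub_image {R₀ : Ordinal.{u} → Set (Set Ordinal.{u})}
    {i τ : Ordinal.{u}} (ha : IsNormalBelow a τ δ) (hi : i < τ) (hc : IsCoherentClub R₀ δs c i)
    (hδs : Order.IsSuccLimit δs) (hlim : ∀ j ∈ c, Order.IsSuccLimit j)
    (hR : ∀ j ∈ c, ∀ m < j, a '' (c ∩ Iio m) ∈ R (a j)) :
    IsCoherentClub R δs (a '' c) (a i) where
  isClubOf := (ha.mono hi (hc.isSuccLimit hδs)).isClubOf_image hc.isClubOf
  otp_eq := (otp_image ((ha.strictMonoOn.mono (Iio_subset_Iio hi.le)).mono hc.isClubOf.1)).trans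
    hc.otp_eq
  coherent β hβ := by
    have hcτ : c ⊆ Iio τ := hc.isClubOf.1.trans (Iio_subset_Iio hi.le)
    obtain ⟨j, hj, m, hm, rfl, inter_eq⟩ := ha.exists_lt_of_mem_nacc_image hcτ hlim hβ
    exact inter_eq ▸ hR j hj m hm

theorem IsGuessingScheme.transfer {R₀ : Ordinal.{u} → Set (Set Ordinal.{u})}
    (h : IsGuessingScheme τ δs R₀ Q) (hτ : τ.IsRegular) (hunc : ℵ₀ < τ) (hlam : lam.IsRegular)
    (hτlam : τ < lam) (hδs : Order.IsSuccLimit δs) :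
    IsGuessingScheme lam δs (transferSystem τ.ord Q)
      (image2 (fun δ c => normalSeq τ.ord δ '' c) (Iio lam.ord) Q) := by
  have hQ : #Q < Cardinal.lift.{u + 1} lam := h.card_le.trans_lt (Cardinal.lift_lt.2 hτlam)
  have hτord : τ.ord < lam.ord := ord_lt_ord.2 hτlam
  refine ⟨fun β hβ => mk_transferSystem_lt hlam.aleph0_le hτlam hQ hβ, ?_, fun E hE => ?_⟩
  · refine mk_image2_le.trans (mul_le_of_le (Cardinal.aleph0_le_lift.2 hlam.aleph0_le) ?_ hQ.le)
    exact (mk_Iio_ord lam).le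
  · obtain ⟨a, ha, haE, capture⟩ := exists_isNormalBelow_capturing hlam hE hQ
      (monotone_transferSystem τ.ord Q)
    have haτ := ha.mono hτord (isSuccLimit_ord hτ.aleph0_le)
    obtain ⟨c, hcQ, i, hi, hc, hcF⟩ :=
      h.guess _ (IsNormalBelow.isClubOf_eq hτ hunc (isNormalBelow_normalSeq haτ) haτ)
    have image_eq {x : Set Ordinal.{u}} (hx : x ⊆ c) :
        normalSeq τ.ord (a τ.ord) '' x = a '' x := image_congr fun j hj => (hcF (hx hj)).2.2
    refine ⟨a '' c, ⟨a τ.ord, ha.lt _ hτord, c, hcQ, image_eq subset_rfl⟩, a i,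
      ha.lt i (hi.trans hτord), ?_, image_subset_iff.2 fun j hj => haE ((hcF hj).1.trans hτord)⟩
    refine haτ.isCoherentClub_image hi hc hδs (fun j hj => (hcF hj).2.1) fun j hj m hm => ?_
    refine capture j ((hcF hj).1.trans hτord) m hm c hcQ (a τ.ord) (ha.lt _ hτord) ?_
    exact ⟨a τ.ord, mem_Iic.2 le_rfl, c ∩ Iio m, ⟨c, hcQ, m, hm.trans (hcF hj).1, rfl⟩,
      image_eq inter_subset_left⟩

end Transfer

section Filtration

/-- `s` is an increasing continuous sequence of sets of fewer than `μ` ordinals whose union over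
the ordinals below `μ` is `β`. -/
structure IsOrdinalFiltration (s : Ordinal.{u} → Set Ordinal.{u}) (μ : Cardinal.{u})
    (β : Ordinal.{u}) : Prop where
  monotone : Monotone s
  subset : ∀ i, s i ⊆ Iio β
  continuous : ∀ i, Order.IsSuccLimit i → ∀ x ∈ s i, ∃ k < i, x ∈ s k
  card_lt : ∀ i < μ.ord, #(s i) < Cardinal.lift.{u + 1} μ
  exhausts : ∀ x < β, ∃ i < μ.ord, x ∈ s i

variable {μ : Cardinal.{u}} {β δ : Ordinal.{u}} {A C : Set Ordinal.{u}}
  {s : Ordinal.{u} → Set Ordinal.{u}} {a : Ordinal.{u} → Ordinal.{u} → Set Ordinal.{u}}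
  {f : Ordinal.{u} → Ordinal.{u}}

theorem exists_isOrdinalFiltration (hμ : ℵ₀ ≤ μ) (hβ : β.card ≤ μ) :
    ∃ s, IsOrdinalFiltration s μ β := by
  have mk_le : #(Iio β) ≤ #(Iio μ.ord) := by
    rw [Cardinal.mk_Iio_ordinal, mk_Iio_ord]
    exact Cardinal.lift_le.2 hβ
  obtain ⟨g⟩ := (Cardinal.le_def _ _).1 mk_le
  have succ_lt (x : Iio β) : Order.succ (g x).1 < μ.ord := (isSuccLimit_ord hμ).succ_lt (g x).2
  refine ⟨fun i => {x | ∃ hx : x < β, (g ⟨x, hx⟩).1 < i}, fun i j hij x ⟨hx, hgx⟩ =>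
    ⟨hx, hgx.trans_le hij⟩, fun i x ⟨hx, _⟩ => hx, fun i hi x ⟨hx, hgx⟩ =>
    ⟨_, hi.succ_lt hgx, hx, Order.lt_succ _⟩, fun i hi => ?_, fun x hx =>
    ⟨_, succ_lt ⟨x, hx⟩, hx, Order.lt_succ _⟩⟩
  refine lt_of_le_of_lt (mk_le_of_injective (f := fun x => (⟨(g ⟨x, x.2.1⟩).1, x.2.2⟩ : Iio i)) ?_)
    (mk_Iio_lt_lift hi)
  intro x y hxy
  have g_eq : g ⟨x, x.2.1⟩ = g ⟨y, y.2.1⟩ := Subtype.ext (Subtype.mk.inj hxy)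
  exact Subtype.ext (Subtype.mk.inj (g.injective g_eq))

theorem IsOrdinalFiltration.exists_subset (hs : IsOrdinalFiltration s μ β) (hμ : μ.IsRegular)
    (hA : A ⊆ Iio β) (hcard : #A < Cardinal.lift.{u + 1} μ) : ∃ i < μ.ord, A ⊆ s i :=
  exists_uniform_of_mk_lt_cof (hμ.cof_ord.symm ▸ hcard) (fun _ _ _ _ hij hx => hs.monotone hij hx)
    fun x hx => hs.exhausts x (hA hx)

theorem exists_forall_mem_filtration (hμ : μ.IsRegular)
    (ha : ∀ β ≤ δ, IsOrdinalFiltration (a β) μ β) (hf : ∀ x, f x ≤ x) {k : Ordinal.{u}}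
    (hk : k < μ.ord) :
    ∃ m < μ.ord, ∀ β ∈ a δ k, a β k ⊆ a δ m ∧ a δ k ∩ Iio β ⊆ a β m ∧ f β ∈ a δ m := by
  have hδ := ha δ le_rfl
  refine exists_uniform_of_mk_lt_cof (hμ.cof_ord.symm ▸ hδ.card_lt k hk)
    (fun β hβ m m' hm => ?_) fun β hβ => ?_
  · have hβδ : β ≤ δ := le_of_lt (hδ.subset k hβ)
    exact fun h => ⟨h.1.trans (hδ.monotone hm), h.2.1.trans ((ha β hβδ).monotone hm),
      hδ.monotone hm h.2.2⟩
  · have hβδ : β < δ := hδ.subset k hβ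
    obtain ⟨m₁, hm₁, h₁⟩ := hδ.exists_subset hμ
      (((ha β hβδ.le).subset k).trans (Iio_subset_Iio hβδ.le)) ((ha β hβδ.le).card_lt k hk)
    obtain ⟨m₂, hm₂, h₂⟩ := (ha β hβδ.le).exists_subset hμ (A := a δ k ∩ Iio β) inter_subset_right
      ((mk_le_mk_of_subset inter_subset_left).trans_lt (hδ.card_lt k hk))
    obtain ⟨m₃, hm₃, h₃⟩ := hδ.exhausts (f β) ((hf β).trans_lt hβδ)
    exact ⟨max m₁ (max m₂ m₃), max_lt hm₁ (max_lt hm₂ hm₃),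
      h₁.trans (hδ.monotone (le_max_left _ _)),
      h₂.trans ((ha β hβδ.le).monotone ((le_max_left _ _).trans (le_max_right _ _))),
      hδ.monotone ((le_max_right _ _).trans (le_max_right _ _)) h₃⟩

theorem exists_coherent_filtration_index (hμ : μ.IsRegular) (hunc : ℵ₀ < μ)
    (ha : ∀ β ≤ δ, IsOrdinalFiltration (a β) μ β) (hf : ∀ x, f x ≤ x) (hC : C ⊆ Iio δ)
    (hcard : #C < Cardinal.lift.{u + 1} μ) :
    ∃ i < μ.ord, C ⊆ a δ i ∧ (∀ β ∈ a δ i, a β i = a δ i ∩ Iio β) ∧ MapsTo f (a δ i) (a δ i) := by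
  have hδ := ha δ le_rfl
  obtain ⟨i₀, hi₀, hCi₀⟩ := hδ.exists_subset hμ hC hcard
  obtain ⟨i, hi, hi₀i, hlim, closed⟩ := exists_closure_point hμ hunc
    (fun k hk => exists_forall_mem_filtration hμ ha hf hk) hi₀
  refine ⟨i, hi, hCi₀.trans (hδ.monotone hi₀i.le), fun β hβ => Subset.antisymm (fun x hx => ?_)
    fun x ⟨hx, hxβ⟩ => ?_, fun β hβ => ?_⟩ <;>
    obtain ⟨k₁, hk₁, hβk₁⟩ := hδ.continuous i hlim β hβ
  · have hβ' := ha β (le_of_lt (hδ.subset i hβ))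
    obtain ⟨k₂, hk₂, hxk₂⟩ := hβ'.continuous i hlim x hx
    obtain ⟨m, hm, h⟩ := closed (max k₁ k₂) (max_lt hk₁ hk₂)
    refine ⟨hδ.monotone hm.le ((h β (hδ.monotone (le_max_left _ _) hβk₁)).1 ?_), hβ'.subset i hx⟩
    exact hβ'.monotone (le_max_right _ _) hxk₂
  · obtain ⟨k₂, hk₂, hxk₂⟩ := hδ.continuous i hlim x hx
    obtain ⟨m, hm, h⟩ := closed (max k₁ k₂) (max_lt hk₁ hk₂)
    refine (ha β (le_of_lt (hδ.subset i hβ))).monotone hm.le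
      ((h β (hδ.monotone (le_max_left _ _) hβk₁)).2.1 ⟨?_, hxβ⟩)
    exact hδ.monotone (le_max_right _ _) hxk₂
  · obtain ⟨m, hm, h⟩ := closed k₁ hk₁
    exact hδ.monotone hm.le (h β hβk₁).2.2

end Filtration

section LastPoint

variable {α γ θ x : Ordinal.{u}} {A C E G : Set Ordinal.{u}} {F : Ordinal.{u} → Set Ordinal.{u}}

/-- The last point of `E` that is at most `α`, for `E` closed. It is `0` when there is no such
point, because `sSup ∅ = 0`. -/
noncomputable def lastPoint (E : Set Ordinal.{u}) (α : Ordinal.{u}) : Ordinal.{u} :=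
  sSup (E ∩ Iic α)

theorem lastPoint_le (E : Set Ordinal.{u}) (α : Ordinal.{u}) : lastPoint E α ≤ α :=
  csSup_le' fun _ hx => hx.2

theorem le_lastPoint (hx : x ∈ E) (h : x ≤ α) : x ≤ lastPoint E α :=
  le_csSup ⟨α, fun _ hy => hy.2⟩ ⟨hx, h⟩

theorem lastPoint_eq_self (h : α ∈ E) : lastPoint E α = α :=
  (lastPoint_le E α).antisymm (le_lastPoint h le_rfl)

theorem lastPoint_lastPoint (E : Set Ordinal.{u}) (α : Ordinal.{u}) :
    lastPoint E (lastPoint E α) = lastPoint E α :=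
  (lastPoint_le E _).antisymm
    (csSup_le' fun _ hx => le_lastPoint hx.1 (le_lastPoint hx.1 hx.2))

theorem lastPoint_mono (h : E ⊆ G) (α : Ordinal.{u}) : lastPoint E α ≤ lastPoint G α :=
  csSup_le' fun _ hx => le_lastPoint (h hx.1) hx.2

theorem lastPoint_mem (hE : IsClosedSubset E γ) (hα : α < γ) (h0 : lastPoint E α ≠ 0) :
    lastPoint E α ∈ E := by
  by_contra hmem
  refine hmem ((isClosedSubset_iff.1 hE).2 _ ((lastPoint_le E α).trans_lt hα)
    (accPt_iff_exists_between.2 ⟨h0, fun b hb => ?_⟩))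
  obtain ⟨y, hy, hby⟩ := exists_lt_of_lt_csSup' hb
  exact ⟨y, hy.1, hby, (le_lastPoint hy.1 hy.2).lt_of_ne (ne_of_mem_of_not_mem hy.1 hmem)⟩

theorem exists_lastPoint_eq (hθ : 0 < θ) (hα : α < γ) (hF : ∀ ζ < θ, IsClosedSubset (F ζ) γ)
    (hanti : Antitone F) (hinter : ∀ x < γ, (∀ ζ < θ, x ∈ F ζ) → x ∈ F θ) :
    ∃ ζ < θ, ∀ ξ < θ, ζ ≤ ξ → lastPoint (F ξ) α = lastPoint (F θ) α := by
  -- `lastPoint (F ξ) α` decreases with `ξ`, hence stabilizes at its least value.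
  obtain ⟨ζ, hζ, hζ_min⟩ : sInf ((fun ζ => lastPoint (F ζ) α) '' Iio θ) ∈ _ :=
    csInf_mem ⟨_, 0, hθ, rfl⟩
  have eq_of_ge (ξ : Ordinal.{u}) (hξ : ξ < θ) (h : ζ ≤ ξ) :
      lastPoint (F ξ) α = lastPoint (F ζ) α :=
    (lastPoint_mono (hanti h) α).antisymm (hζ_min.trans_le (csInf_le' ⟨ξ, hξ, rfl⟩))
  refine ⟨ζ, hζ, fun ξ hξ h => (eq_of_ge ξ hξ h).trans
    (le_antisymm ?_ (lastPoint_mono (hanti hζ.le) α))⟩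
  by_cases h0 : lastPoint (F ζ) α = 0
  · exact h0 ▸ zero_le
  · refine le_lastPoint (hinter _ ((lastPoint_le _ α).trans_lt hα) fun ξ hξ => ?_)
      (lastPoint_le _ α)
    have hmax : max ξ ζ < θ := max_lt hξ hζ
    refine hanti (le_max_left ξ ζ) ?_
    rw [← eq_of_ge _ hmax (le_max_right _ _)] at h0 ⊢
    exact lastPoint_mem (hF _ hmax) hα h0

/-- The last points of `E` below the elements of `A`, except for `0`, which may be the default
value of `lastPoint`. -/
noncomputable def lastPoints (E A : Set Ordinal.{u}) : Set Ordinal.{u} :=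
  lastPoint E '' A \ {0}

theorem lastPoints_congr (h : ∀ x ∈ A, lastPoint E x = lastPoint G x) :
    lastPoints E A = lastPoints G A := by
  rw [lastPoints, lastPoints, image_congr h]

theorem lastPoints_subset (hE : IsClosedSubset E γ) (hA : A ⊆ Iio γ) : lastPoints E A ⊆ E := by
  rintro _ ⟨⟨x, hx, rfl⟩, h0⟩
  exact lastPoint_mem hE (hA hx) h0

theorem subset_lastPoints (hCE : C ⊆ E \ {0}) (hCA : C ⊆ A) : C ⊆ lastPoints E A := fun x hx =>
  ⟨⟨x, hCA hx, lastPoint_eq_self (hCE hx).1⟩, (hCE hx).2⟩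

theorem lastPoints_inter_Iio (hA : MapsTo (lastPoint E) A A) (β : Ordinal.{u}) :
    lastPoints E A ∩ Iio β = lastPoints E (A ∩ Iio β) := by
  refine Subset.antisymm ?_ ?_
  · rintro _ ⟨⟨⟨x, hx, rfl⟩, h0⟩, hβ⟩
    exact ⟨⟨lastPoint E x, ⟨hA hx, hβ⟩, lastPoint_lastPoint E x⟩, h0⟩
  · rintro _ ⟨⟨x, hx, rfl⟩, h0⟩
    exact ⟨⟨mem_image_of_mem _ hx.1, h0⟩, (lastPoint_le E x).trans_lt hx.2⟩

end LastPoint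

section Selection

variable {β : Ordinal.{u}} {A B C : Set Ordinal.{u}} {T : Set Ordinal.{u + 1}}
  {f : Ordinal.{u} → Ordinal.{u}}

/-- The elements of `B` whose position in the increasing enumeration of `B` belongs to `T`. -/
def select (B : Set Ordinal.{u}) (T : Set Ordinal.{u + 1}) : Set Ordinal.{u} :=
  {β ∈ B | otp (B ∩ Iio β) ∈ T}

theorem select_subset : select B T ⊆ B := sep_subset _ _

theorem select_inter_Iio : select B T ∩ Iio β = select (B ∩ Iio β) T := by
  ext x
  refine ⟨fun ⟨⟨hxB, hxT⟩, hxβ⟩ => ⟨⟨hxB, hxβ⟩, ?_⟩, fun ⟨⟨hxB, hxβ⟩, hxT⟩ => ⟨⟨hxB, ?_⟩, hxβ⟩⟩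
  · rwa [Iio_inter_Iio_of_le (le_of_lt hxβ)]
  · rwa [Iio_inter_Iio_of_le (le_of_lt hxβ)] at hxT

theorem select_image (hC : C ⊆ B) (hf : StrictMonoOn f B) :
    select (f '' B) ((fun c => otp (B ∩ Iio c)) '' C) = f '' C := by
  have otp_eq {x : Ordinal.{u}} (hx : x ∈ B) : otp (f '' B ∩ Iio (f x)) = otp (B ∩ Iio x) := by
    rw [image_inter_Iio_of_strictMonoOn hf hx, otp_image (hf.mono inter_subset_left)]
  ext y
  constructor
  · rintro ⟨⟨x, hx, rfl⟩, c, hc, hcx⟩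
    have x_eq : c = x := (strictMonoOn_otp_inter_Iio B).injOn (hC hc) hx (hcx.trans (otp_eq hx))
    exact ⟨c, hc, congrArg f x_eq⟩
  · rintro ⟨c, hc, rfl⟩
    exact ⟨mem_image_of_mem f (hC hc), c, hc, (otp_eq (hC hc)).symm⟩

/-- `T` tells, for every order type `η`, which positions to select in a set of order type `η` in
order to get a cofinal subset of order type `δs`, whenever there is such a subset. -/
def IsCofinalSelector (T : Ordinal.{u + 1} → Set Ordinal.{u + 1}) (δs : Ordinal.{u + 1}) : Prop :=
  ∀ B C : Set Ordinal.{u}, C ⊆ B → otp C = δs → (∀ b ∈ B, ∃ c ∈ C, b < c) →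
    otp (select B (T (otp B))) = δs ∧ ∀ b ∈ B, ∃ c ∈ select B (T (otp B)), b < c

theorem exists_isCofinalSelector (δs : Ordinal.{u + 1}) : ∃ T, IsCofinalSelector T δs := by
  have exists_positions (η : Ordinal.{u + 1}) : ∃ T : Set Ordinal.{u + 1}, ∀ B C : Set Ordinal.{u},
      otp B = η → C ⊆ B → otp C = δs → (∀ b ∈ B, ∃ c ∈ C, b < c) →
      otp (select B T) = δs ∧ ∀ b ∈ B, ∃ c ∈ select B T, b < c := by
    by_cases h : ∃ B C : Set Ordinal.{u}, otp B = η ∧ C ⊆ B ∧ otp C = δs ∧ ∀ b ∈ B, ∃ c ∈ C, b < c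
    · obtain ⟨B, C, hB, hCB, hC, hcof⟩ := h
      refine ⟨(fun c => otp (B ∩ Iio c)) '' C, fun B' _ hB' _ _ _ => ?_⟩
      obtain ⟨f, hf, rfl⟩ := exists_strictMonoOn_image_eq (hB.trans hB'.symm)
      rw [select_image hCB hf]
      refine ⟨(otp_image (hf.mono hCB)).trans hC, forall_mem_image.2 fun b hb => ?_⟩
      obtain ⟨c, hc, hbc⟩ := hcof b hb
      exact ⟨f c, mem_image_of_mem f hc, hf hb (hCB hc) hbc⟩
    · exact ⟨∅, fun B C hB hCB hC hcof => absurd ⟨B, C, hB, hCB, hC, hcof⟩ h⟩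
  choose T hT using exists_positions
  exact ⟨T, fun B C => hT _ B C rfl⟩

end Selection

section IteratedRefinement

variable {γ ζ ξ x : Ordinal.{u}} {G : Set Ordinal.{u} → Set Ordinal.{u}}

/-- The decreasing sequence of subsets of `γ` obtained by intersecting repeatedly with `G E`, for
`E` an earlier set of the sequence. -/
def iteratedRefinement (γ : Ordinal.{u}) (G : Set Ordinal.{u} → Set Ordinal.{u})
    (ζ : Ordinal.{u}) : Set Ordinal.{u} :=
  {x | x < γ ∧ ∀ ξ, ∀ _ : ξ < ζ, x ∈ G (iteratedRefinement γ G ξ)}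
termination_by ζ

theorem mem_iteratedRefinement : x ∈ iteratedRefinement γ G ζ ↔
    x < γ ∧ ∀ ξ < ζ, x ∈ G (iteratedRefinement γ G ξ) := by
  rw [iteratedRefinement]
  rfl

theorem antitone_iteratedRefinement : Antitone (iteratedRefinement γ G) := fun ζ ξ h x hx => by
  rw [mem_iteratedRefinement] at hx ⊢
  exact ⟨hx.1, fun ν hν => hx.2 ν (hν.trans_le h)⟩

theorem iteratedRefinement_subset (h : ξ < ζ) :
    iteratedRefinement γ G ζ ⊆ G (iteratedRefinement γ G ξ) := fun _ hx =>
  (mem_iteratedRefinement.1 hx).2 ξ h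

theorem mem_iteratedRefinement_of_forall_lt (hζ : Order.IsSuccLimit ζ) (hx : x < γ)
    (h : ∀ ξ < ζ, x ∈ iteratedRefinement γ G ξ) : x ∈ iteratedRefinement γ G ζ :=
  mem_iteratedRefinement.2 ⟨hx, fun ξ hξ =>
    iteratedRefinement_subset (Order.lt_succ ξ) (h _ (hζ.succ_lt hξ))⟩

theorem isClubOf_iteratedRefinement (hγ : ℵ₀ < γ.cof) (hG : ∀ E, IsClubOf E γ → IsClubOf (G E) γ)
    (hζ : ζ.card < γ.cof) : IsClubOf (iteratedRefinement γ G ζ) γ := by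
  induction ζ using WellFoundedLT.induction with
  | ind ζ ih =>
    rw [iteratedRefinement]
    exact isClubOf_forall_lt hγ hζ fun ξ hξ =>
      hG _ (ih ξ hξ ((Ordinal.card_le_card hξ.le).trans_lt hζ))

end IteratedRefinement

section Successor

variable {lam μ : Cardinal.{u}} {δ δs i η : Ordinal.{u}} {C E : Set Ordinal.{u}}
  {a : Ordinal.{u} → Ordinal.{u} → Set Ordinal.{u}} {T : Ordinal.{u + 1} → Set Ordinal.{u + 1}}
  {F : Ordinal.{u} → Set Ordinal.{u}}

/-- The `(i, η)`-th candidate for a club of `β` guessing subclubs of `E`: project the small set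
`a β i` to `E`, select positions as if the result had order type `η`, and close up. -/
noncomputable def candidate (a : Ordinal.{u} → Ordinal.{u} → Set Ordinal.{u})
    (T : Ordinal.{u + 1} → Set Ordinal.{u + 1}) (E : Set Ordinal.{u}) (β i η : Ordinal.{u}) :
    Set Ordinal.{u} :=
  closure (select (lastPoints E (a β i)) (T (Ordinal.lift.{u + 1} η))) ∩ Iio β

/-- All the candidates at `β` with indices below `μ`. -/
noncomputable def candidateSystem (a : Ordinal.{u} → Ordinal.{u} → Set Ordinal.{u})
    (T : Ordinal.{u + 1} → Set Ordinal.{u + 1}) (μ : Cardinal.{u}) (E : Set Ordinal.{u})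
    (β : Ordinal.{u}) : Set (Set Ordinal.{u}) :=
  image2 (candidate a T E β) (Iio μ.ord) (Iio μ.ord)

theorem mk_candidateSystem_le (hμ : ℵ₀ ≤ μ) (β : Ordinal.{u}) :
    #(candidateSystem a T μ E β) ≤ Cardinal.lift.{u + 1} μ :=
  mk_image2_le.trans (mul_le_of_le (Cardinal.aleph0_le_lift.2 hμ) (mk_Iio_ord μ).le
    (mk_Iio_ord μ).le)

theorem isCoherentClub_candidate (hT : IsCofinalSelector T (Ordinal.lift.{u + 1} δs))
    (hi : i < μ.ord) (hη : η < μ.ord) (hsub : a δ i ⊆ Iio δ)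
    (hcoh : ∀ β ∈ a δ i, a β i = a δ i ∩ Iio β) (hmaps : MapsTo (lastPoint E) (a δ i) (a δ i))
    (hηB : Ordinal.lift.{u + 1} η = otp (lastPoints E (a δ i)))
    (hC : C ⊆ lastPoints E (a δ i)) (hotp : otp C = Ordinal.lift.{u + 1} δs)
    (hcof : ∀ x < δ, ∃ c ∈ C, x < c) :
    IsCoherentClub (candidateSystem a T μ E) δs (candidate a T E δ i η) δ := by
  have hBA : lastPoints E (a δ i) ⊆ a δ i := sdiff_subset.trans hmaps.image_subset
  obtain ⟨select_otp, select_cof⟩ := hT _ C hC hotp fun b hb => hcof b (hsub (hBA hb))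
  rw [← hηB] at select_otp select_cof
  have hDA := (select_subset (T := T (Ordinal.lift.{u + 1} η))).trans hBA
  have hDδ := hDA.trans hsub
  have hDcof (x : Ordinal.{u}) (hx : x < δ) :
      ∃ d ∈ select (lastPoints E (a δ i)) (T (Ordinal.lift.{u + 1} η)), x < d := by
    obtain ⟨c, hc, hxc⟩ := hcof x hx
    exact (select_cof c (hC hc)).imp fun d hd => ⟨hd.1, hxc.trans hd.2⟩
  refine ⟨isClubOf_closure_inter_Iio hDδ hDcof, (otp_closure_inter_Iio hDδ hDcof).trans select_otp,
    fun β hβ => ⟨i, hi, η, hη, ?_⟩⟩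
  have hβA : β ∈ a δ i := hDA (nacc_closure_inter_Iio_subset hβ)
  rw [candidate, candidate, closure_inter_Iio_inter_Iio (le_of_lt (hsub hβA)), select_inter_Iio,
    lastPoints_inter_Iio hmaps, hcoh β hβA]

theorem exists_cofinal_subset_otp_eq (hlam : lam.IsRegular) (hE : IsClubOf E lam.ord)
    (hδs : Order.IsSuccLimit δs) (hlt : δs < lam.ord) :
    ∃ δ < lam.ord, ∃ C ⊆ E, C ⊆ Iio δ ∧ otp C = Ordinal.lift.{u + 1} δs ∧
      ∀ x < δ, ∃ c ∈ C, x < c := by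
  have zero_lt : ∀ k < lam.ord, ∀ _ : Iio k → Ordinal.{u}, 0 < lam.ord := fun _ hk _ => pos_of_gt hk
  let e := sparseEnum E fun _ _ => 0
  have he : IsNormalBelow e lam.ord lam.ord := isNormalBelow_sparseEnum hlam hE zero_lt
  have he' : IsNormalBelow e δs (e δs) := he.mono hlt hδs
  refine ⟨e δs, he.lt δs hlt, e '' Iio δs, ?_, image_subset_iff.2 he'.lt,
    (otp_image he'.strictMonoOn).trans (otp_Iio δs), fun x hx => ?_⟩
  · exact image_subset_iff.2 fun k hk => (sparseEnum_mem hlam hE zero_lt (lt_trans hk hlt)).1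
  · obtain ⟨k, hk, hxk⟩ := he'.cofinal x hx
    exact ⟨e k, mem_image_of_mem e hk, hxk⟩

theorem exists_uniform_lastPoint_eq (hμ : μ.IsRegular) {γ : Ordinal.{u}} {A : Set Ordinal.{u}}
    (hA : A ⊆ Iio γ) (hcard : #A < Cardinal.lift.{u + 1} μ)
    (hF : ∀ ζ < μ.ord, IsClosedSubset (F ζ) γ)
    (hanti : Antitone F) (hinter : ∀ x < γ, (∀ ζ < μ.ord, x ∈ F ζ) → x ∈ F μ.ord) :
    ∃ ζ < μ.ord, ∀ α ∈ A, lastPoint (F ζ) α = lastPoint (F μ.ord) α := by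
  obtain ⟨ζ, hζ, stable⟩ := exists_uniform_of_mk_lt_cof (θ := μ.ord)
    (p := fun α ζ => ∀ ξ < μ.ord, ζ ≤ ξ → lastPoint (F ξ) α = lastPoint (F μ.ord) α)
    (hμ.cof_ord.symm ▸ hcard) (fun _ _ _ _ hζ h ξ hξ hle => h ξ hξ (hζ.trans hle)) fun α hα =>
      exists_lastPoint_eq (isSuccLimit_ord hμ.aleph0_le).bot_lt (hA hα) hF hanti hinter
  exact ⟨ζ, hζ, fun α hα => stable α hα ζ hζ le_rfl⟩

theorem exists_candidate_subset (hμ : μ.IsRegular) (hunc : ℵ₀ < μ) (hlam : lam.IsRegular)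
    (hμlam : μ ≤ lam) (hδs : Order.IsSuccLimit δs) (hδμ : δs < μ.ord)
    (ha : ∀ β < lam.ord, IsOrdinalFiltration (a β) μ β)
    (hT : IsCofinalSelector T (Ordinal.lift.{u + 1} δs))
    (hF : ∀ ζ ≤ μ.ord, IsClubOf (F ζ) lam.ord) (hanti : Antitone F)
    (hinter : ∀ x < lam.ord, (∀ ζ < μ.ord, x ∈ F ζ) → x ∈ F μ.ord) :
    ∃ ζ < μ.ord, ∃ δ < lam.ord, ∃ C ∈ candidateSystem a T μ (F ζ) δ,
      IsCoherentClub (candidateSystem a T μ (F ζ)) δs C δ ∧ C ⊆ F μ.ord := by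
  obtain ⟨δ, hδ, C, hCF, hCδ, hotp, hcof⟩ := exists_cofinal_subset_otp_eq hlam
    ((hF μ.ord le_rfl).diff_singleton_zero (isSuccLimit_ord hlam.aleph0_le)) hδs
    (hδμ.trans_le (ord_le_ord.2 hμlam))
  have hCcard : #C < Cardinal.lift.{u + 1} μ := by
    rw [← Ordinal.card_type (fun x y : C => x < y), ← otp, hotp, ← Ordinal.lift_card]
    exact Cardinal.lift_lt.2 (Cardinal.lt_ord.1 hδμ)
  obtain ⟨i, hi, hCA, hcoh, hmaps⟩ := exists_coherent_filtration_index hμ hunc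
    (fun β hβ => ha β (hβ.trans_lt hδ)) (lastPoint_le (F μ.ord)) hCδ hCcard
  have hAδ : a δ i ⊆ Iio δ := (ha δ hδ).subset i
  have hA : a δ i ⊆ Iio lam.ord := hAδ.trans (Iio_subset_Iio hδ.le)
  have hAcard := (ha δ hδ).card_lt i hi
  obtain ⟨ζ, hζ, stable⟩ := exists_uniform_lastPoint_eq hμ hA hAcard
    (fun ξ hξ => (hF ξ hξ.le).isClosedSubset) hanti hinter
  have lastPoints_eq : lastPoints (F ζ) (a δ i) = lastPoints (F μ.ord) (a δ i) :=
    lastPoints_congr stable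
  obtain ⟨η, hη, hηB⟩ := exists_lift_eq_otp (B := lastPoints (F ζ) (a δ i))
    ((mk_le_mk_of_subset sdiff_subset).trans_lt (mk_image_le.trans_lt hAcard))
  refine ⟨ζ, hζ, δ, hδ, _, ⟨i, hi, η, hη, rfl⟩, isCoherentClub_candidate hT hi hη hAδ hcoh
    (fun x hx => stable x hx ▸ hmaps hx) hηB (lastPoints_eq ▸ subset_lastPoints hCF hCA) hotp hcof,
    ?_⟩
  rw [candidate, lastPoints_eq]
  have hclosed := (hF μ.ord le_rfl).isClosedSubset
  exact hclosed.closure_inter_Iio_subset (select_subset.trans (lastPoints_subset hclosed hA)) hδ.le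

theorem exists_isGuessingScheme_succ (hμ : μ.IsRegular) (hunc : ℵ₀ < μ)
    (hδs : Order.IsSuccLimit δs) (hδμ : δs < μ.ord) :
    ∃ R W, IsGuessingScheme (Order.succ μ) δs R W := by
  have hlam : (Order.succ μ).IsRegular := isRegular_succ hμ.aleph0_le
  have hμlam : μ < Order.succ μ := Order.lt_succ μ
  have exists_filtration (β : Ordinal.{u}) (hβ : β < (Order.succ μ).ord) :
      ∃ s, IsOrdinalFiltration s μ β :=
    exists_isOrdinalFiltration hμ.aleph0_le (Order.lt_succ_iff.1 (Cardinal.lt_ord.1 hβ))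
  choose! a ha using exists_filtration
  obtain ⟨T, hT⟩ := exists_isCofinalSelector (Ordinal.lift.{u + 1} δs)
  by_contra! no_scheme
  have exists_unguessed (E : Set Ordinal.{u}) : ∃ G, IsClubOf G (Order.succ μ).ord ∧
      ∀ δ < (Order.succ μ).ord, ∀ C ∈ candidateSystem a T μ E δ,
        IsCoherentClub (candidateSystem a T μ E) δs C δ → ¬ C ⊆ G := by
    by_contra! guess
    refine no_scheme (candidateSystem a T μ E)
      (⋃ δ ∈ Iio (Order.succ μ).ord, candidateSystem a T μ E δ) ⟨fun α _ => ?_, ?_, fun G hG => ?_⟩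
    · exact (mk_candidateSystem_le hμ.aleph0_le α).trans_lt (Cardinal.lift_lt.2 hμlam)
    · refine (mk_biUnion_le _ _).trans (mul_le_of_le (Cardinal.aleph0_le_lift.2 hlam.aleph0_le)
        (mk_Iio_ord _).le (ciSup_le' fun δ => ?_))
      exact (mk_candidateSystem_le hμ.aleph0_le δ.1).trans (Cardinal.lift_le.2 hμlam.le)
    · obtain ⟨δ, hδ, C, hC, h⟩ := guess G hG
      exact ⟨C, mem_biUnion hδ hC, δ, hδ, h⟩
  choose G hG not_subset using exists_unguessed
  let F := iteratedRefinement (Order.succ μ).ord G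
  have hF (ζ : Ordinal.{u}) (hζ : ζ ≤ μ.ord) : IsClubOf (F ζ) (Order.succ μ).ord :=
    isClubOf_iteratedRefinement (hlam.cof_ord.symm ▸ hunc.trans hμlam) (fun E _ => hG E)
      (hlam.cof_ord.symm ▸ Cardinal.lt_ord.1 (hζ.trans_lt (ord_lt_ord.2 hμlam)))
  obtain ⟨ζ, hζ, δ, hδ, C, hC, hCδ, hCF⟩ := exists_candidate_subset hμ hunc hlam hμlam.le hδs hδμ
    ha hT hF antitone_iteratedRefinement
    fun x => mem_iteratedRefinement_of_forall_lt (isSuccLimit_ord hμ.aleph0_le)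
  exact not_subset _ δ hδ C hC hCδ (hCF.trans (iteratedRefinement_subset hζ))

end Successor

theorem mainTheorem6 (lam : Cardinal.{u}) (δs : Ordinal.{u}) (hδs : Order.IsSuccLimit δs)
    (hreg : lam.ord.cof = lam) (hlam : Order.succ δs.card < lam) :
    ∃ (S : Set Ordinal.{u}) (P₁ P₂ : Ordinal.{u} → Set (Set Ordinal.{u})),
      IsStationaryIn S lam.ord ∧
      S ⊆ {δ | δ < lam.ord ∧ δ.cof = δs.cof} ∧
      GuessingFamilies lam δs S P₁ P₂ := by
  have aleph0_le : ℵ₀ ≤ δs.card := Ordinal.aleph0_le_card.2 (omega0_le_of_isSuccLimit hδs)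
  have hμ : (Order.succ δs.card).IsRegular := isRegular_succ aleph0_le
  have hunc : ℵ₀ < Order.succ δs.card := aleph0_le.trans_lt (Order.lt_succ _)
  have hlamreg : lam.IsRegular := ⟨(hunc.trans hlam).le, hreg.ge⟩
  obtain ⟨R₀, Q, succ_scheme⟩ :=
    exists_isGuessingScheme_succ hμ hunc hδs (Cardinal.lt_ord.2 (Order.lt_succ _))
  obtain ⟨R, W, scheme⟩ : ∃ R W, IsGuessingScheme lam δs R W := by
    rcases (Order.succ_le_of_lt hlam).eq_or_lt with rfl | hlt
    · exact ⟨R₀, Q, succ_scheme⟩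
    · exact ⟨_, _, succ_scheme.transfer (isRegular_succ hμ.aleph0_le)
        (hunc.trans (Order.lt_succ _)) hlamreg hlt hδs⟩
  exact ⟨_, _, _, scheme.isStationaryIn hδs, subset_rfl, scheme.guessingFamilies hδs⟩
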